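/- **Setting.** Let $\mathcal G=(V,E_\to)$ be a finite directed graph without self-loops (a mixed graph with no bidirected edges). Write $\mathrm{pa}(v)=\{u: u\to v\}$ and $\mathrm{pa}(U)=\bigcup_{u\in U}\mathrm{pa}(u)$. Let $\mathbb R^{\mathcal G}$ be the space of real $V\times V$ matrices $\Lambda=(\lambda_{uv})$ with $\lambda_{uv}=0$ whenever $u\to v$ is not an edge, and let $\mathbb R^{\mathcal G}_{\mathrm{reg}}=\{\Lambda\in\mathbb R^{\mathcal G}:\det(I-\Lambda)\ne 0\}$. Fix a probability space rich enough to carry a random variable that is uniform on $[0,1]$. Let $\mathcal M$ be the set of random vectors $\varepsilon=(\varepsilon_v)_{v\in V}$ on it such that $\varepsilon_C$ and $\varepsilon_{V\setminus C}$ are independent for every singleton $C\subseteq V$ (equivalently, the coordinates are mutually independent; this is the connected set Markov property for the empty bidirected graph). Call $\varepsilon\in\mathcal M$ *generic* if for all $a_1,a_2\in\mathbb R^V$, independence of $a_1^T\varepsilon$ and $a_2^T\varepsilon$ implies $a_{1u}a_{2u}=0$ for all $u\in V$. The graph $\mathcal G$ is *generically identifiable* if there is a Lebesgue null set $N\subset\mathbb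 R^{\mathcal G}$ such that for every $\Lambda\in\mathbb R^{\mathcal G}_{\mathrm{reg}}\setminus N$ and every generic $\varepsilon\in\mathcal M$, $$\{\tilde\Lambda\in\mathbb R^{\mathcal G}_{\mathrm{reg}}:\ (I-\tilde\Lambda)^{-T}\tilde\varepsilon\overset{d}{=}(I-\Lambda)^{-T}\varepsilon\ \text{ for some }\tilde\varepsilon\in\mathcal M\}=\{\Lambda\}.$$ For $k\ge 2$, a set $C$ of $k$ vertices is a *$k$-cycle* of $\mathcal G$ if its vertices can be numbered $v_1,\dots,v_k$ so that the edges of $\mathcal G$ among them are exactly $v_1\to v_2\to\cdots\to v_k\to v_1$. **Theorem 6.5.** Suppose that $V$ is a disjoint union $V=C_1\,\dot\cup\cdots\dot\cup\, C_n$, where each $C_i$ is a $k_i$-cycle of $\mathcal G$ and $\mathrm{pa}(C_i)\subseteq C_1\cup\cdots\cup C_i$. Then $\mathcal G$ is generically identifiable if and only if no $2$-cycle $C=\{v_1,v_2\}$ of $\mathcal G$ satisfies $$\mathrm{pa}(C)\setminus C=\mathrm{pa}(v_1)\setminus C=\mathrm{pa}(v_2)\setminus C .$$ -/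

import Mathlib

open MeasureTheory ProbabilityTheory

/-- A mixed graph on the vertex set `V`: directed edges without self-loops, and bidirected
edges, which form a simple (symmetric, loopless) graph. Directed cycles are allowed. -/
structure MixedGraph (V : Type*) where
  /-- `dir.Adj u v` means that there is a directed edge `u → v`. -/
  dir : Digraph V
  dir_loopless : ∀ v, ¬ dir.Adj v v
  /-- `bidir.Adj u v` means that there is a bidirected edge `u ↔ v`. -/
  bidir : SimpleGraph V

namespace MixedGraph

section Graph

variable {V : Type*} (G : MixedGraph V)

/-- The set of parents of a vertex. -/
def pa (v : V) : Set V := {u | G.dir.Adj u v}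

/-- The parents of a set of vertices: the union of the parent sets of its members. -/
def paSet (U : Set V) : Set V := ⋃ u ∈ U, G.pa u

/-- `Sib(U)`: the members of `U` together with all their bidirected neighbours. -/
def sibSet (U : Set V) : Set V := ⋃ u ∈ U, (G.bidir.neighborSet u ∪ {u})

/-- The set `C` is a directed `k`-cycle of `G`: it consists of `k ≥ 2` distinct vertices
`c 0, c 1, …, c (k - 1)`, and the directed edges of `G` among them are exactly
`c 0 → c 1 → ⋯ → c (k - 1) → c 0`. -/
def IsCycle (k : ℕ) (C : Set V) : Prop :=
  2 ≤ k ∧ ∃ c : ZMod k → V, Function.Injective c ∧ Set.range c = C ∧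
    ∀ i j : ZMod k, G.dir.Adj (c i) (c j) ↔ j = i + 1

/-- The type of directed edges. -/
abbrev Edge : Type _ := {e : V × V // G.dir.Adj e.1 e.2}

open Classical in
/-- The matrix whose `(u, v)` entry is the weight of the edge `u → v`, and `0` if there is no
such edge. This identifies `ℝ^E`, `E` the set of directed edges, with the space of coefficient
matrices. -/
noncomputable def weightMatrix (x : G.Edge → ℝ) : Matrix V V ℝ :=
  fun u v => if h : G.dir.Adj u v then x ⟨(u, v), h⟩ else 0

/-- The linear space of coefficient matrices: `Λ u v = 0` unless `u → v` is an edge. -/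
def coeffSpace : Set (Matrix V V ℝ) := {Λ | ∀ u v, ¬ G.dir.Adj u v → Λ u v = 0}

open Classical in
/-- The matrices in `N` that belong to the space of coefficient matrices form a Lebesgue null
set of that space, in the coordinates given by the edge weights. -/
def IsNull [Fintype V] (N : Set (Matrix V V ℝ)) : Prop :=
  volume {x : G.Edge → ℝ | G.weightMatrix x ∈ N} = 0

/-- The coefficient matrices `Λ` for which `I - Λ` is invertible. -/
def regCoeffSpace [Fintype V] [DecidableEq V] : Set (Matrix V V ℝ) :=
  {Λ | Λ ∈ G.coeffSpace ∧ (1 - Λ).det ≠ 0}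

end Graph

section Model

variable {V : Type*} [Fintype V] [DecidableEq V] (G : MixedGraph V)
  {Ω : Type*} [MeasurableSpace Ω] (P : Measure Ω)

/-- The random vectors on `(Ω, P)` that satisfy the connected set Markov property with respect
to the bidirected part of `G`: for every nonempty `C` that is connected in the bidirected part,
the subvectors indexed by `C` and by the complement of `Sib(C)` are independent. -/
def errorModel : Set (Ω → V → ℝ) :=
  {ε | Measurable ε ∧ ∀ C : Set V, (G.bidir.induce C).Connected →
    IndepFun (fun ω (u : C) => ε ω u) (fun ω (u : ↥(G.sibSet C)ᶜ) => ε ω u) P}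

/-- The genericity condition on an error vector: independence of two linear combinations of the
errors forces `a₁ u * a₂ v = 0` whenever `u = v` or `u ↔ v`. -/
def IsGenericError (ε : Ω → V → ℝ) : Prop :=
  ∀ a₁ a₂ : V → ℝ, IndepFun (fun ω => a₁ ⬝ᵥ ε ω) (fun ω => a₂ ⬝ᵥ ε ω) P →
    ∀ u v, (u = v ∨ G.bidir.Adj u v) → a₁ u * a₂ v = 0

/-- The solution `X = (I - Λ)⁻ᵀ ε` of the structural equations `X = Λᵀ X + ε`. -/
noncomputable def param (Λ : Matrix V V ℝ) (ε : Ω → V → ℝ) : Ω → V → ℝ :=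
  fun ω => Matrix.mulVec ((1 - Λ)⁻¹.transpose) (ε ω)

/-- The fiber over `X`: all regular coefficient matrices and errors in the model that produce a
random vector with the same distribution as `X`. -/
def fiber (X : Ω → V → ℝ) : Set (Matrix V V ℝ × (Ω → V → ℝ)) :=
  {q | q.1 ∈ G.regCoeffSpace ∧ q.2 ∈ G.errorModel P ∧ IdentDistrib (param q.1 q.2) X P P}

/-- Generic identifiability of the graph: outside a fixed Lebesgue null set of coefficient
matrices, and for every generic error vector, the coefficient matrix `Λ` is the only one in the
fiber over `(I - Λ)⁻ᵀ ε`. -/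
def GenericallyIdentifiable : Prop :=
  ∃ N : Set (Matrix V V ℝ), G.IsNull N ∧
    ∀ Λ ∈ G.regCoeffSpace, Λ ∉ N → ∀ ε ∈ G.errorModel P, G.IsGenericError P ε →
      Prod.fst '' G.fiber P (param Λ ε) = {Λ}

end Model

end MixedGraph

/-! Write `B = (1 - Λ)⁻¹ (1 - Λ')` for a competitor `Λ'` of `Λ`. Its error vector has the law of `Bᵀ
ε`, and its coordinates are independent, so genericity of `ε` makes the columns of `B` disjointly
supported. As `B` is invertible it is monomial: `1 - Λ'` arises from `1 - Λ` by permuting and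
rescaling columns (`inv_mul_apply_mul_eq_zero_of_identDistrib`, `eq_of_one_sub_mul_monomial`).

If no edge weight vanishes, column `v` of `1 - Λ` has support `closedPa v`. Hence an admissible
permutation preserves closed parent sets. It is trivial if these sets are distinct, and the unit
diagonal then fixes the scaling. If two of them agree, swapping the two columns gives a second
solution (`exists_ne_mem_fiber`). Two distinct vertices share a closed parent set exactly when they
form a 2-cycle with the same outside parents (`injective_closedPa_iff`). -/

namespace MixedGraph

/-! ### Closed parent sets and 2-cycles -/

section Graph

variable {V : Type*} (G : MixedGraph V)

/-- A vertex together with its parents. -/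
def closedPa (v : V) : Set V := insert v (G.pa v)

lemma mem_closedPa {u v : V} : u ∈ G.closedPa v ↔ u = v ∨ G.dir.Adj u v := Iff.rfl

/-- In a loopless graph, a `2`-cycle is a pair of distinct vertices joined in both directions. -/
lemma isCycle_two_iff {v w : V} :
    G.IsCycle 2 {v, w} ↔ v ≠ w ∧ G.dir.Adj v w ∧ G.dir.Adj w v := by
  constructor
  · rintro ⟨-, c, hc, hr, hadj⟩
    have h01 : c 0 ≠ c 1 := fun h => absurd (hc h) (by decide)
    have a01 : G.dir.Adj (c 0) (c 1) := (hadj 0 1).2 (by decide)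
    have a10 : G.dir.Adj (c 1) (c 0) := (hadj 1 0).2 (by decide)
    have key : ∀ i : ZMod 2, i = 0 ∨ i = 1 := by decide
    obtain ⟨i, hi⟩ : v ∈ Set.range c := hr ▸ Set.mem_insert _ _
    obtain ⟨j, hj⟩ : w ∈ Set.range c := hr ▸ Set.mem_insert_of_mem _ rfl
    have hcard : v ≠ w := by
      rintro rfl
      have h0 : c 0 ∈ ({v, v} : Set V) := hr ▸ Set.mem_range_self 0
      have h1 : c 1 ∈ ({v, v} : Set V) := hr ▸ Set.mem_range_self 1
      simp only [Set.mem_insert_iff, Set.mem_singleton_iff, or_self] at h0 h1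
      exact h01 (h0.trans h1.symm)
    refine ⟨hcard, ?_⟩
    rcases key i with rfl | rfl <;> rcases key j with rfl | rfl <;> subst hi hj <;> simp_all
  · rintro ⟨hvw, h1, h2⟩
    have key : ∀ i : ZMod 2, i = 0 ∨ i = 1 := by decide
    have h10 : (1 : ZMod 2) ≠ 0 := by decide
    have h11 : (1 : ZMod 2) + 1 = 0 := by decide
    refine ⟨le_rfl, fun i => if i = 0 then v else w, ?_, ?_, ?_⟩
    · intro i j hij
      rcases key i with rfl | rfl <;> rcases key j with rfl | rfl <;> simp_all
    · ext u
      simp only [Set.mem_range, Set.mem_insert_iff, Set.mem_singleton_iff]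
      constructor
      · rintro ⟨i, rfl⟩
        rcases key i with rfl | rfl <;> simp
      · rintro (rfl | rfl)
        exacts [⟨0, by simp⟩, ⟨1, by simp⟩]
    · intro i j
      have hv := G.dir_loopless v
      have hw := G.dir_loopless w
      rcases key i with rfl | rfl <;> rcases key j with rfl | rfl <;> simp_all

/-- Distinct vertices have distinct closed parent sets iff the two vertices of a `2`-cycle never
have the same parents outside of the cycle. -/
lemma injective_closedPa_iff :
    Function.Injective G.closedPa ↔
      ∀ v₁ v₂ : V, G.IsCycle 2 {v₁, v₂} →
        ¬ (G.paSet {v₁, v₂} \ {v₁, v₂} = G.pa v₁ \ {v₁, v₂} ∧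
           G.pa v₁ \ {v₁, v₂} = G.pa v₂ \ {v₁, v₂}) := by
  constructor
  · rintro h v w hc ⟨-, heq⟩
    obtain ⟨hne, h1, h2⟩ := G.isCycle_two_iff.1 hc
    refine hne (h (Set.ext fun u => ?_))
    have := Set.ext_iff.1 heq u
    simp only [Set.mem_sdiff, pa, Set.mem_ofPred_eq, Set.mem_insert_iff,
      Set.mem_singleton_iff, not_or] at this
    rw [mem_closedPa, mem_closedPa]
    by_cases hu : u = v
    · subst hu; simp [h1]
    · by_cases hu' : u = w
      · subst hu'; simp [h2]
      · simp_all
  · intro h v w heq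
    by_contra hne
    have hm : ∀ u, (u = v ∨ G.dir.Adj u v) ↔ (u = w ∨ G.dir.Adj u w) := Set.ext_iff.1 heq
    -- Each vertex lies in its own closed parent set, hence in that of the other.
    have h1 : G.dir.Adj v w := ((hm v).1 (Or.inl rfl)).resolve_left hne
    have h2 : G.dir.Adj w v := ((hm w).2 (Or.inl rfl)).resolve_left (Ne.symm hne)
    have hpa : G.pa v \ {v, w} = G.pa w \ {v, w} := by
      ext u
      have := hm u
      simp only [Set.mem_sdiff, pa, Set.mem_ofPred_eq, Set.mem_insert_iff,
        Set.mem_singleton_iff, not_or]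
      grind
    refine h v w (G.isCycle_two_iff.2 ⟨hne, h1, h2⟩) ⟨?_, hpa⟩
    rw [paSet, Set.biUnion_pair, Set.union_sdiff_distrib, ← hpa, Set.union_self]

lemma weightMatrix_mem_coeffSpace (x : G.Edge → ℝ) : G.weightMatrix x ∈ G.coeffSpace := by
  intro u v h
  simp [weightMatrix, h]

end Graph

/-! ### Supports of the columns of `1 - Λ` -/

section Coeff

variable {V : Type*} [DecidableEq V] {G : MixedGraph V}

lemma one_sub_apply_ne_zero_iff {Λ : Matrix V V ℝ} (hΛ : Λ ∈ G.coeffSpace)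
    (hne : ∀ u v, G.dir.Adj u v → Λ u v ≠ 0) (u v : V) :
    (1 - Λ) u v ≠ 0 ↔ u ∈ G.closedPa v := by
  rw [mem_closedPa, Matrix.sub_apply]
  by_cases huv : u = v
  · subst huv
    simp [hΛ u u (G.dir_loopless u)]
  · by_cases h : G.dir.Adj u v
    · simp [huv, h, hne u v h]
    · simp [huv, h, hΛ u v h]

lemma one_sub_apply_self {Λ : Matrix V V ℝ} (hΛ : Λ ∈ G.coeffSpace) (v : V) :
    (1 - Λ) v v = 1 := by
  simp [hΛ v v (G.dir_loopless v)]

/-- The inclusion that survives when weights may vanish, as they may for a competitor `Λ'`. -/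
lemma mem_closedPa_of_one_sub_apply_ne_zero {Λ : Matrix V V ℝ} (hΛ : Λ ∈ G.coeffSpace) {u v : V}
    (h : (1 - Λ) u v ≠ 0) : u ∈ G.closedPa v := by
  by_contra hn
  rw [mem_closedPa, not_or] at hn
  exact h (by simp [hn.1, hΛ u v hn.2])

end Coeff

/-! ### Null sets of coefficient matrices -/

section Null

variable {V : Type*} [Fintype V] (G : MixedGraph V)

open Classical in
-- A finite union of coordinate hyperplanes. It serves as the exceptional set for identifiability.
lemma isNull_exists_weight_eq_zero :
    G.IsNull {Λ | ∃ u v, G.dir.Adj u v ∧ Λ u v = 0} := by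
  unfold IsNull
  refine measure_mono_null (t := ⋃ e : G.Edge, {x : G.Edge → ℝ | x e = 0}) ?_ ?_
  · rintro x ⟨u, v, huv, h⟩
    refine Set.mem_iUnion.2 ⟨⟨(u, v), huv⟩, ?_⟩
    simpa [weightMatrix, huv] using h
  · exact measure_iUnion_null fun e => Measure.pi_hyperplane _ e 0

open Classical in
/-- Outside any null set there is a regular coefficient matrix none of whose edge weights
vanishes. -/
lemma exists_mem_regCoeffSpace_notMem [DecidableEq V] {N : Set (Matrix V V ℝ)} (hN : G.IsNull N) :
    ∃ Λ ∈ G.regCoeffSpace, Λ ∉ N ∧ ∀ u v, G.dir.Adj u v → Λ u v ≠ 0 := by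
  have hcont : Continuous fun x : G.Edge → ℝ => (1 - G.weightMatrix x).det := by
    refine Continuous.matrix_det (continuous_const.sub ?_)
    refine continuous_matrix fun u v => ?_
    unfold weightMatrix
    split_ifs
    · fun_prop
    · fun_prop
  have hopen : IsOpen {x : G.Edge → ℝ | (1 - G.weightMatrix x).det ≠ 0} :=
    isOpen_ne_fun hcont continuous_const
  have hzero : G.weightMatrix 0 = 0 := by
    ext u v
    simp [weightMatrix]
  -- The regular locus is open and contains `0`, so it has positive measure and no null set covers
  -- it.
  have hpos := hopen.measure_pos volume ⟨0, by simp [hzero]⟩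
  have hnull := measure_union_null hN G.isNull_exists_weight_eq_zero
  obtain ⟨x, hx, hx'⟩ : ∃ x ∈ {x : G.Edge → ℝ | (1 - G.weightMatrix x).det ≠ 0},
      x ∉ {x | G.weightMatrix x ∈ N} ∪
        {x | G.weightMatrix x ∈ {Λ | ∃ u v, G.dir.Adj u v ∧ Λ u v = 0}} := by
    by_contra! hsub
    exact hpos.ne' (measure_mono_null hsub hnull)
  refine ⟨G.weightMatrix x, ⟨G.weightMatrix_mem_coeffSpace x, hx⟩, fun h => hx' (Or.inl h),
    fun u v huv h => hx' (Or.inr ⟨u, v, huv, h⟩)⟩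

end Null

/-! ### Error vectors: the Markov property and a generic example -/

/-- If `y` has coordinates in `{0, 1}` and attains the maximum of a linear form over the cube,
then its coordinates with nonzero coefficient are determined. -/
lemma eq_indicator_of_dotProduct_eq {V : Type*} [Fintype V] {a y : V → ℝ} (hy : ∀ v, y v = 0 ∨ y v = 1)
    (h : a ⬝ᵥ y = a ⬝ᵥ fun v => if 0 < a v then 1 else 0) {u : V} (hu : a u ≠ 0) :
    y u = if 0 < a u then 1 else 0 := by
  -- The bound holds summand by summand, so equal sums force equal summands.
  have hle : ∀ v ∈ Finset.univ, a v * y v ≤ a v * (if 0 < a v then 1 else 0) := by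
    intro v _
    rcases hy v with hv | hv <;> rw [hv] <;> split_ifs <;> linarith
  exact mul_left_cancel₀ hu ((Finset.sum_eq_sum_iff_of_le hle).1 h u (Finset.mem_univ u))

section ErrorModel

variable {V : Type*} {G : MixedGraph V}
  {Ω : Type*} [MeasurableSpace Ω] {P : Measure Ω}

/-- Without bidirected edges, the Markov property says that each coordinate is independent of the
vector of the remaining ones. -/
lemma mem_errorModel_iff (hG : G.bidir = ⊥) {ε : Ω → V → ℝ} :
    ε ∈ G.errorModel P ↔ Measurable ε ∧ ∀ v,
      IndepFun (fun ω => ε ω v) (fun ω (u : {u // u ≠ v}) => ε ω u) P := by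
  have hsib : ∀ C, G.sibSet C = C := by
    intro C
    ext u
    simp [sibSet, hG, SimpleGraph.neighborSet]
  constructor
  · rintro ⟨hm, h⟩
    refine ⟨hm, fun v => ?_⟩
    have hv := h {v} (by
      have : Nonempty ({v} : Set V) := ⟨⟨v, rfl⟩⟩
      exact ⟨SimpleGraph.Preconnected.of_subsingleton⟩)
    rw [hsib] at hv
    exact hv.comp (φ := fun x : ({v} : Set V) → ℝ => x ⟨v, rfl⟩)
      (ψ := fun (y : ↥({v} : Set V)ᶜ → ℝ) (u : {u // u ≠ v}) => y ⟨u.1, u.2⟩)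
      (by fun_prop) (by fun_prop)
  · rintro ⟨hm, h⟩
    refine ⟨hm, fun C hC => ?_⟩
    rw [hsib]
    obtain ⟨⟨v, hv⟩⟩ := hC.nonempty
    -- With no bidirected edges, a connected set is a single vertex.
    have hCv : ∀ u : C, u.1 = v := by
      intro u
      by_contra hne
      have : Nontrivial C := ⟨u, ⟨v, hv⟩, fun h => hne (congrArg Subtype.val h)⟩
      obtain ⟨w, hw⟩ := hC.preconnected.exists_adj_of_nontrivial u
      simp [hG] at hw
    have h1 := (h v).comp (φ := fun (x : ℝ) (_ : C) => x)
      (ψ := fun (y : {u // u ≠ v} → ℝ) (u : ↥Cᶜ) => y ⟨u.1, fun hu => u.2 (hu ▸ hv)⟩)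
      (by fun_prop) (by fun_prop)
    have h2 : (fun ω (u : C) => ε ω u) = (fun (x : ℝ) (_ : C) => x) ∘ fun ω => ε ω v := by
      funext ω u
      simp [hCv u]
    rw [h2]
    exact h1

/-- A random vector that charges all vertices of the unit cube, and nothing else, is generic. -/
lemma isGenericError_of_cube [Fintype V] (hG : G.bidir = ⊥) {ε : Ω → V → ℝ}
    (h01 : ∀ ω v, ε ω v = 0 ∨ ε ω v = 1)
    (hpos : ∀ x : V → ℝ, (∀ v, x v = 0 ∨ x v = 1) → P {ω | ε ω = x} ≠ 0) :
    G.IsGenericError P ε := by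
  have key : ∀ a b : V → ℝ, IndepFun (fun ω => a ⬝ᵥ ε ω) (fun ω => b ⬝ᵥ ε ω) P →
      ∀ u, 0 ≤ a u * b u := by
    intro a b hind u
    -- Each form attains its maximum over the cube with positive probability, so by independence
    -- both do at once. Opposite signs of `a u` and `b u` would then force two different values of
    -- `ε ω u`.
    by_contra! hlt
    set x : (V → ℝ) → V → ℝ := fun a v => if 0 < a v then 1 else 0
    have hx : ∀ a v, x a v = 0 ∨ x a v = 1 := by
      intro a v
      by_cases h : 0 < a v <;> simp [x, h]
    have hPpos : ∀ a : V → ℝ, P ((fun ω => a ⬝ᵥ ε ω) ⁻¹' {a ⬝ᵥ x a}) ≠ 0 := by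
      intro a h0
      refine hpos (x a) (hx a) (measure_mono_null ?_ h0)
      rintro ω (hω : ε ω = x a)
      simp [hω]
    have hinter := hind.measure_inter_preimage_eq_mul _ _ (MeasurableSet.singleton (a ⬝ᵥ x a))
      (MeasurableSet.singleton (b ⬝ᵥ x b))
    have hne := hinter ▸ mul_ne_zero (hPpos a) (hPpos b)
    obtain ⟨ω, ha, hb⟩ := nonempty_of_measure_ne_zero hne
    have ha' := eq_indicator_of_dotProduct_eq (h01 ω) ha (left_ne_zero_of_mul hlt.ne)
    have hb' := eq_indicator_of_dotProduct_eq (h01 ω) hb (right_ne_zero_of_mul hlt.ne)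
    rw [ha'] at hb'
    rcases mul_neg_iff.1 hlt with ⟨h1, h2⟩ | ⟨h1, h2⟩
    · simp [h1, h2.not_gt] at hb'
    · simp [h2, h1.not_gt] at hb'
  intro a b hind u v huv
  obtain rfl : u = v := by simpa [hG] using huv
  -- Applying `key` to `b` and to `-b` bounds the product from both sides.
  have h1 := key a b hind u
  have h2 := key a (-b) (by
    simp only [neg_dotProduct]
    exact hind.comp measurable_id measurable_neg) u
  simp only [Pi.neg_apply, mul_neg] at h2
  linarith

lemma indepFun_of_mem_errorModel (hG : G.bidir = ⊥) {ε : Ω → V → ℝ} (hε : ε ∈ G.errorModel P)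
    {u v : V} (huv : u ≠ v) : IndepFun (fun ω => ε ω u) (fun ω => ε ω v) P :=
  (((mem_errorModel_iff hG).1 hε).2 u).comp (φ := id)
    (ψ := fun y : {w // w ≠ u} → ℝ => y ⟨v, huv.symm⟩) measurable_id (by fun_prop)

/-- The model is stable under permuting and rescaling the coordinates. -/
lemma smul_comp_perm_mem_errorModel (hG : G.bidir = ⊥) {ε : Ω → V → ℝ} (hε : ε ∈ G.errorModel P)
    (c : V → ℝ) (σ : Equiv.Perm V) : (fun ω v => c v * ε ω (σ v)) ∈ G.errorModel P := by
  rw [mem_errorModel_iff hG] at hε ⊢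
  refine ⟨by have := hε.1; fun_prop, fun v => ?_⟩
  exact (hε.2 (σ v)).comp (φ := fun x => c v * x)
    (ψ := fun (y : {u // u ≠ σ v} → ℝ) (u : {u // u ≠ v}) =>
      c u * y ⟨σ u, fun h => u.2 (σ.injective h)⟩) (by fun_prop) (by fun_prop)

variable [Fintype V] [DecidableEq V]

lemma measurable_param (Λ : Matrix V V ℝ) {ε : Ω → V → ℝ} (hε : Measurable ε) :
    Measurable (param Λ ε) := by
  have : Measurable fun x : V → ℝ => Matrix.mulVec ((1 - Λ)⁻¹.transpose) x :=
    (Continuous.matrix_mulVec continuous_const continuous_id).measurable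
  exact this.comp hε

/-- A space that carries a uniform random variable carries a generic error vector. -/
lemma exists_isGenericError (hG : G.bidir = ⊥) [IsProbabilityMeasure P]
    (hP : ∃ U : Ω → ℝ, Measurable U ∧ P.map U = volume.restrict (Set.Icc (0 : ℝ) 1)) :
    ∃ ε ∈ G.errorModel P, G.IsGenericError P ε := by
  obtain ⟨U, hU, hUmap⟩ := hP
  -- The law of independent fair bits. It charges every vertex of the cube and is the image of the
  -- uniform law on the unit interval.
  let μ : Measure (V → Bool) :=
    Measure.pi fun _ => (PMF.uniformOfFintype Bool).toMeasure
  obtain ⟨f, hf, hfμ⟩ := μ.exists_measurable_map_eq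
  -- `U` is real-valued and lies in the interval only almost surely; projecting makes it
  -- interval-valued without changing the law.
  have hproj : Measurable (Set.projIcc (0 : ℝ) 1 zero_le_one) := continuous_projIcc.measurable
  have hUI : P.map (Set.projIcc (0 : ℝ) 1 zero_le_one ∘ U) = volume := by
    have hsub : (volume : Measure ℝ).restrict (Set.Icc 0 1) =
        (volume : Measure (Set.Icc (0 : ℝ) 1)).map Subtype.val :=
      (map_comap_subtype_coe measurableSet_Icc volume).symm
    have hid : Set.projIcc (0 : ℝ) 1 zero_le_one ∘ Subtype.val = id :=
      funext fun x => Set.projIcc_val _ x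
    rw [← Measure.map_map hproj hU, hUmap, hsub, Measure.map_map hproj measurable_subtype_coe, hid,
      Measure.map_id]
  let B : Ω → V → Bool := fun ω => f (Set.projIcc (0 : ℝ) 1 zero_le_one (U ω))
  have hB : Measurable B := hf.comp (hproj.comp hU)
  have hBmap : P.map B = μ := by
    rw [← hfμ, ← hUI, Measure.map_map hf (hproj.comp hU)]
    rfl
  let g : Bool → ℝ := fun b => if b then 1 else 0
  have hg : Measurable g := measurable_of_finite g
  have hεm : Measurable fun ω v => g (B ω v) := by fun_prop
  have hiB : iIndepFun (fun v ω => B ω v) P := by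
    rw [iIndepFun_iff_map_fun_eq_pi_map fun v => by fun_prop]
    change P.map B = _
    rw [hBmap]
    refine congrArg Measure.pi (funext fun v => ?_)
    have hev := (measurePreserving_eval
      (fun _ : V => (PMF.uniformOfFintype Bool).toMeasure) v).map_eq
    rw [← hev]
    change μ.map _ = _
    rw [← hBmap, Measure.map_map (measurable_pi_apply v) hB]
    rfl
  have hind : iIndepFun (fun v ω => g (B ω v)) P := hiB.comp (fun _ => g) fun _ => hg
  refine ⟨fun ω v => g (B ω v), (mem_errorModel_iff hG).2 ⟨hεm, fun v => ?_⟩,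
    isGenericError_of_cube hG ?_ ?_⟩
  · have h1 := hind.indepFun_finset {v} {v}ᶜ disjoint_compl_right fun _ => by fun_prop
    exact h1.comp (φ := fun x : ({v} : Finset V) → ℝ => x ⟨v, by simp⟩)
      (ψ := fun (y : ↥({v}ᶜ : Finset V) → ℝ) (u : {u // u ≠ v}) => y ⟨u.1, by simpa using u.2⟩)
      (by fun_prop) (by fun_prop)
  · intro ω v
    cases B ω v <;> simp [g]
  · intro x hx h0
    let b : V → Bool := fun v => x v = 1
    have hb : μ {b} ≠ 0 := by
      simp only [μ, Measure.pi_singleton]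
      refine Finset.prod_ne_zero_iff.2 fun v _ => ?_
      rw [PMF.toMeasure_apply_singleton _ _ (MeasurableSet.singleton _)]
      simp
    rw [← hBmap, Measure.map_apply hB (MeasurableSet.singleton b)] at hb
    refine hb (measure_mono_null ?_ h0)
    rintro ω (hω : B ω = b)
    funext v
    rcases hx v with h | h <;> simp [hω, b, g, h]

end ErrorModel

/-! ### Fibers over generic errors -/

section Identifiability

variable {V : Type*} [Fintype V] [DecidableEq V] {G : MixedGraph V}
  {Ω : Type*} [MeasurableSpace Ω] {P : Measure Ω}

/-- Two coefficient matrices in one fiber over a generic error differ by a matrix each of whose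
rows has at most one nonzero entry. -/
lemma inv_mul_apply_mul_eq_zero_of_identDistrib (hG : G.bidir = ⊥)
    [IsProbabilityMeasure P] {Λ Λ' : Matrix V V ℝ}
    (hΛ' : (1 - Λ').det ≠ 0) {ε ε' : Ω → V → ℝ} (hgen : G.IsGenericError P ε)
    (hε' : ε' ∈ G.errorModel P)
    (hid : IdentDistrib (param Λ' ε') (param Λ ε) P P) {i j : V} (hij : i ≠ j) (u : V) :
    ((1 - Λ)⁻¹ * (1 - Λ')) u i * ((1 - Λ)⁻¹ * (1 - Λ')) u j = 0 := by
  have hcomp : ∀ i j : V, Measurable fun x : V → ℝ =>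
      ((Matrix.mulVec (1 - Λ').transpose x) i, (Matrix.mulVec (1 - Λ').transpose x) j) := by
    intro i j
    have : Continuous fun x : V → ℝ => Matrix.mulVec (1 - Λ').transpose x :=
      Continuous.matrix_mulVec continuous_const continuous_id
    exact (((continuous_apply i).comp this).prodMk ((continuous_apply j).comp this)).measurable
  have h1 := hid.comp (hcomp i j)
  have e1 : ∀ ω, Matrix.mulVec (1 - Λ').transpose (param Λ' ε' ω) = ε' ω := by
    intro ω
    rw [param, Matrix.mulVec_mulVec, ← Matrix.transpose_mul,
      Matrix.nonsing_inv_mul _ (isUnit_iff_ne_zero.2 hΛ'), Matrix.transpose_one, Matrix.one_mulVec]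
  have e2 : ∀ ω k, Matrix.mulVec (1 - Λ').transpose (param Λ ε ω) k =
      (fun u => ((1 - Λ)⁻¹ * (1 - Λ')) u k) ⬝ᵥ ε ω := by
    intro ω k
    rw [param, Matrix.mulVec_mulVec, ← Matrix.transpose_mul]
    rfl
  have h2 : IdentDistrib (fun ω => (ε' ω i, ε' ω j))
      (fun ω => ((fun u => ((1 - Λ)⁻¹ * (1 - Λ')) u i) ⬝ᵥ ε ω,
        (fun u => ((1 - Λ)⁻¹ * (1 - Λ')) u j) ⬝ᵥ ε ω)) P P := by
    simpa only [Function.comp_def, e1, e2] using h1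
  have hind := indepFun_of_mem_errorModel hG hε' hij
  have m1 : AEMeasurable (fun ω => ε' ω i) P := h2.aemeasurable_fst.fst
  have m2 : AEMeasurable (fun ω => ε' ω j) P := h2.aemeasurable_fst.snd
  have m3 := h2.aemeasurable_snd.fst
  have m4 := h2.aemeasurable_snd.snd
  refine hgen (fun u => ((1 - Λ)⁻¹ * (1 - Λ')) u i) (fun u => ((1 - Λ)⁻¹ * (1 - Λ')) u j) ?_ u u
    (Or.inl rfl)
  -- Independence depends only on the joint law, so it passes from the coordinates of `ε'` to the
  -- linear forms in `ε`.
  rw [indepFun_iff_map_prod_eq_prod_map_map m1 m2] at hind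
  rw [indepFun_iff_map_prod_eq_prod_map_map m3 m4]
  rw [← h2.map_eq, hind]
  exact congrArg₂ Measure.prod (h2.comp measurable_fst).map_eq (h2.comp measurable_snd).map_eq

/-- If closed parent sets are distinct, `1 - Λ` is determined up to right multiplication by
monomial matrices. -/
lemma eq_of_one_sub_mul_monomial (hinj : Function.Injective G.closedPa) {Λ Λ' : Matrix V V ℝ}
    (hΛ : Λ ∈ G.coeffSpace) (hne : ∀ u v, G.dir.Adj u v → Λ u v ≠ 0)
    (hΛ' : Λ' ∈ G.regCoeffSpace) {B : Matrix V V ℝ} (hB : 1 - Λ' = (1 - Λ) * B)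
    (hmono : ∀ i j, i ≠ j → ∀ u, B u i * B u j = 0) : Λ' = Λ := by
  have hdet : B.det ≠ 0 := by
    have := hΛ'.2
    rw [hB, Matrix.det_mul] at this
    exact right_ne_zero_of_mul this
  have hcol : ∀ i, ∃ u, B u i ≠ 0 := by
    intro i
    by_contra! h
    exact hdet (Matrix.det_eq_zero_of_column_eq_zero i h)
  choose σ hσ using hcol
  -- Disjoint supports make the chosen rows distinct. So `σ` is a permutation, every row is taken by
  -- some column, and no other entries survive.
  have hσinj : Function.Injective σ := by
    intro i j hij
    by_contra h
    exact mul_ne_zero (hσ i) (hij ▸ hσ j) (hmono i j h (σ i))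
  have hσbij : Function.Bijective σ := Finite.injective_iff_bijective.1 hσinj
  have hzero : ∀ u j, u ≠ σ j → B u j = 0 := by
    intro u j huj
    obtain ⟨i, rfl⟩ := hσbij.2 u
    have hij : i ≠ j := fun h => huj (h ▸ rfl)
    exact (mul_eq_zero.1 (hmono i j hij (σ i))).resolve_left (hσ i)
  have hentry : ∀ v j, (1 - Λ') v j = (1 - Λ) v (σ j) * B (σ j) j := by
    intro v j
    rw [hB, Matrix.mul_apply]
    refine Finset.sum_eq_single _ (fun u _ hu => ?_) (by simp)
    rw [hzero u j hu, mul_zero]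
  have hsub : ∀ j, G.closedPa (σ j) ⊆ G.closedPa j := by
    intro j v hv
    refine mem_closedPa_of_one_sub_apply_ne_zero hΛ'.1 ?_
    rw [hentry]
    exact mul_ne_zero ((one_sub_apply_ne_zero_iff hΛ hne _ _).2 hv) (hσ j)
  -- A permutation preserves the total size of the closed parent sets, so no inclusion in `hsub` is
  -- strict.
  have hcard : ∑ j, (G.closedPa (σ j)).ncard = ∑ j, (G.closedPa j).ncard :=
    hσbij.sum_comp fun j => (G.closedPa j).ncard
  have hid : ∀ j, σ j = j := by
    intro j
    refine hinj (Set.eq_of_subset_of_ncard_le (hsub j) (le_of_eq ?_) (Set.toFinite _))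
    exact ((Finset.sum_eq_sum_iff_of_le fun j _ => Set.ncard_le_ncard (hsub j) (Set.toFinite _)).1
      hcard j (Finset.mem_univ j)).symm
  have hone : ∀ j, B j j = 1 := by
    intro j
    have h := hentry j j
    rw [hid j, one_sub_apply_self hΛ, one_sub_apply_self hΛ'.1, one_mul] at h
    exact h.symm
  refine sub_right_injective (b := (1 : Matrix V V ℝ)) (Matrix.ext fun v j => ?_)
  have h := hentry v j
  rwa [hid j, hone j, mul_one] at h

/-- Swapping two columns of `1 - Λ` and rescaling yields another member of the fiber, provided
that the closed parent sets of the two vertices agree. -/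
lemma exists_ne_mem_fiber (hG : G.bidir = ⊥) {v w : V} (hvw : v ≠ w)
    (hpa : G.closedPa v = G.closedPa w) {Λ : Matrix V V ℝ} (hΛ : Λ ∈ G.regCoeffSpace)
    (hne : ∀ u v, G.dir.Adj u v → Λ u v ≠ 0) {ε : Ω → V → ℝ} (hε : ε ∈ G.errorModel P) :
    ∃ Λ' ∈ Prod.fst '' G.fiber P (param Λ ε), Λ' ≠ Λ := by
  let σ : Equiv.Perm V := Equiv.swap v w
  have hσpa : ∀ j, G.closedPa (σ j) = G.closedPa j := by
    intro j
    by_cases h1 : j = v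
    · subst h1; simp [σ, hpa]
    · by_cases h2 : j = w
      · subst h2; simp [σ, hpa]
      · simp [σ, Equiv.swap_apply_of_ne_of_ne h1 h2]
  -- These entries become the diagonal after the swap; dividing by them restores the unit diagonal.
  have hd : ∀ j, (1 - Λ) j (σ j) ≠ 0 := fun j =>
    (one_sub_apply_ne_zero_iff hΛ.1 hne _ _).2 (hσpa j ▸ Or.inl rfl)
  let d : V → ℝ := fun j => ((1 - Λ) j (σ j))⁻¹
  have hd0 : ∀ j, d j ≠ 0 := fun j => inv_ne_zero (hd j)
  let Q : Matrix V V ℝ := Matrix.of fun u j => if u = σ j then d j else 0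
  have hMQ : ∀ u j, ((1 - Λ) * Q) u j = (1 - Λ) u (σ j) * d j := by
    intro u j
    simp [Matrix.mul_apply, Q]
  have hQT : ∀ x : V → ℝ, Matrix.mulVec Q.transpose x = fun j => d j * x (σ j) := by
    intro x
    funext j
    simp [Matrix.mulVec, dotProduct, Q]
  have hQdet : Q.det ≠ 0 := by
    have : Q.transpose.mulVec.Injective := by
      intro x y hxy
      rw [hQT, hQT] at hxy
      funext u
      have := congrFun hxy (σ.symm u)
      simpa [hd0] using this
    rw [Matrix.mulVec_injective_iff_isUnit, Matrix.isUnit_iff_isUnit_det,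
      Matrix.det_transpose] at this
    exact this.ne_zero
  let Λ' : Matrix V V ℝ := 1 - (1 - Λ) * Q
  have hΛ'1 : 1 - Λ' = (1 - Λ) * Q := sub_sub_cancel _ _
  refine ⟨Λ', ⟨(Λ', fun ω j => d j * ε ω (σ j)), ⟨⟨?_, ?_⟩, ?_, ?_⟩, rfl⟩, ?_⟩
  · intro u j huj
    simp only [Λ', Matrix.sub_apply 1 ((1 - Λ) * Q), hMQ]
    by_cases h : u = j
    · subst h
      simp only [d, Matrix.one_apply_eq, mul_inv_cancel₀ (hd u), sub_self]
    · have h0 : (1 - Λ) u (σ j) = 0 := by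
        by_contra h0
        rw [← ne_eq, one_sub_apply_ne_zero_iff hΛ.1 hne, hσpa j, mem_closedPa] at h0
        exact h0.elim h huj
      rw [h0, Matrix.one_apply_ne h]
      simp
  · rw [hΛ'1, Matrix.det_mul]
    exact mul_ne_zero hΛ.2 hQdet
  · exact smul_comp_perm_mem_errorModel hG hε d σ
  -- The new error is `Qᵀ ε`, and `Q` cancels: the two solutions agree pointwise, not just in law.
  · have : param Λ' (fun ω j => d j * ε ω (σ j)) = param Λ ε := by
      funext ω
      simp only [param]
      rw [hΛ'1, ← hQT, Matrix.mulVec_mulVec, ← Matrix.transpose_mul, Matrix.mul_inv_rev,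
        ← mul_assoc, Matrix.mul_nonsing_inv _ (isUnit_iff_ne_zero.2 hQdet), one_mul]
    rw [this]
    exact IdentDistrib.refl (measurable_param Λ hε.1).aemeasurable
  · intro h
    have h1 : (1 - Λ) * Q = (1 - Λ) * 1 := by rw [← hΛ'1, h, mul_one]
    have h2 : Q = 1 := by
      have := congrArg (fun M => (1 - Λ)⁻¹ * M) h1
      simpa only [Matrix.nonsing_inv_mul_cancel_left _ _ (isUnit_iff_ne_zero.2 hΛ.2)] using this
    -- But `Q v v = 0`, because the swap moves `v`.
    have h3 : Q v v = 1 := by rw [h2, Matrix.one_apply_eq]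
    simp [Q, σ, hvw] at h3

/-- Without bidirected edges, a graph is generically identifiable iff distinct vertices have
distinct closed parent sets. -/
theorem genericallyIdentifiable_iff_injective_closedPa (hG : G.bidir = ⊥)
    [IsProbabilityMeasure P]
    (hP : ∃ U : Ω → ℝ, Measurable U ∧ P.map U = volume.restrict (Set.Icc (0 : ℝ) 1)) :
    G.GenericallyIdentifiable P ↔ Function.Injective G.closedPa := by
  constructor
  · rintro ⟨N, hN, h⟩ v w hpa
    by_contra hvw
    obtain ⟨ε, hε, hgen⟩ := exists_isGenericError hG hP
    obtain ⟨Λ, hΛ, hΛN, hne⟩ := G.exists_mem_regCoeffSpace_notMem hN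
    obtain ⟨Λ', hΛ', hΛ'ne⟩ := exists_ne_mem_fiber hG hvw hpa hΛ hne hε
    rw [h Λ hΛ hΛN ε hε hgen] at hΛ'
    exact hΛ'ne hΛ'
  · intro hinj
    refine ⟨_, G.isNull_exists_weight_eq_zero, fun Λ hΛ hΛN ε hε hgen => ?_⟩
    have hne : ∀ u v, G.dir.Adj u v → Λ u v ≠ 0 := fun u v huv h => hΛN ⟨u, v, huv, h⟩
    refine Set.eq_singleton_iff_unique_mem.2 ⟨⟨(Λ, ε), ⟨hΛ, hε, ?_⟩, rfl⟩, ?_⟩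
    · exact IdentDistrib.refl (measurable_param Λ hε.1).aemeasurable
    · rintro _ ⟨⟨Λ', ε'⟩, ⟨hΛ', hε', hid⟩, rfl⟩
      exact eq_of_one_sub_mul_monomial hinj hΛ.1 hne hΛ'
        (Matrix.mul_nonsing_inv_cancel_left _ _ (isUnit_iff_ne_zero.2 hΛ.2)).symm
        fun i j hij u => inv_mul_apply_mul_eq_zero_of_identDistrib hG hΛ'.2 hgen hε' hid hij u

end Identifiability

end MixedGraph

theorem theorem6p5 {V : Type*} [Fintype V] [DecidableEq V] (G : MixedGraph V)
    (hG : G.bidir = ⊥)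
    {Ω : Type*} [MeasurableSpace Ω] (P : Measure Ω) [IsProbabilityMeasure P]
    (hP : ∃ U : Ω → ℝ, Measurable U ∧ P.map U = volume.restrict (Set.Icc (0 : ℝ) 1))
    (n : ℕ) (C : Fin n → Set V) (k : Fin n → ℕ)
    (hcover : ⋃ i, C i = Set.univ)
    (hdisj : Pairwise fun i j => Disjoint (C i) (C j))
    (hcycle : ∀ i, G.IsCycle (k i) (C i))
    (hpa : ∀ i, G.paSet (C i) ⊆ ⋃ j ≤ i, C j) :
    G.GenericallyIdentifiable P ↔
      ∀ v₁ v₂ : V, G.IsCycle 2 {v₁, v₂} →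
        ¬ (G.paSet {v₁, v₂} \ {v₁, v₂} = G.pa v₁ \ {v₁, v₂} ∧
           G.pa v₁ \ {v₁, v₂} = G.pa v₂ \ {v₁, v₂}) := by
  exact (MixedGraph.genericallyIdentifiable_iff_injective_closedPa hG hP).trans
    G.injective_closedPa_iff
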